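/- Let $2^\omega$ be the Cantor space with the product topology, and let $$\mathrm{non}(\mathcal M)=\min\{|Y| : Y\subseteq 2^\omega \text{ is nonmeager}\}.$$ Let $\mathbf\Sigma^0_1$ be the class of open subsets of $2^\omega$ and, for $1<\alpha<\omega_1$, let $\mathbf\Sigma^0_\alpha$ be the class of countable unions of sets each of which is the complement of a $\mathbf\Sigma^0_\beta$ set for some $1\le\beta<\alpha$. For $X\subseteq 2^\omega$ let the Borel order $\mathrm{ord}(X)$ be the smallest $\alpha<\omega_1$ such that for every Borel set $A\subseteq 2^\omega$ there is a $\mathbf\Sigma^0_\alpha$ set $B\subseteq 2^\omega$ with $A\cap X=B\cap X$; if there is no such $\alpha<\omega_1$, let $\mathrm{ord}(X)=\omega_1$. Theorem. There exists $X\subseteq 2^\omega$ with $|X|\le \mathrm{non}(\mathcal M)$ and $\mathrm{ord}(X)=\omega_1$. -/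

import Mathlib

open scoped Ordinal Cardinal

/-- The Cantor space `2^ω`, with the product topology. -/
abbrev CantorSpace : Type := ℕ → Bool

/-- `IsSigmaZero α A`: the set `A` belongs to the (boldface) additive Borel class `Σ⁰_α`.
`Σ⁰_1` consists of the open sets; for `α > 1`, `Σ⁰_α` consists of the countable unions of sets
whose complements lie in `Σ⁰_β` for some `β < α` (depending on the set). The classes are indexed
from `1`: no set satisfies the predicate for `α = 0`, so that `β ≥ 1` is automatic. -/
inductive IsSigmaZero {T : Type} [TopologicalSpace T] : Ordinal.{0} → Set T → Prop
  | of_isOpen (U : Set T) (hU : IsOpen U) : IsSigmaZero 1 U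
  | iUnion (α : Ordinal.{0}) (hα : 1 < α) (A : ℕ → Set T) (β : ℕ → Ordinal.{0})
      (hβ : ∀ n, β n < α) (hA : ∀ n, IsSigmaZero (β n) (A n)ᶜ) : IsSigmaZero α (⋃ n, A n)

/-- `non(M)`: the least cardinality of a nonmeager subset of the Cantor space. -/
noncomputable def nonMeager : Cardinal.{0} :=
  sInf {κ : Cardinal.{0} | ∃ Y : Set CantorSpace, ¬ IsMeagre Y ∧ #Y = κ}

/-- Every Borel subset of the Cantor space agrees on `X` with some `Σ⁰_α` subset. -/
def BorelTraceBound (X : Set CantorSpace) (α : Ordinal.{0}) : Prop :=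
  ∀ A : Set CantorSpace, @MeasurableSet CantorSpace (borel CantorSpace) A →
    ∃ B : Set CantorSpace, IsSigmaZero α B ∧ A ∩ X = B ∩ X

/-- The Borel order `ord(X)`: the least `α < ω₁` such that every Borel set agrees on `X` with
some `Σ⁰_α` set, and `ω₁` if there is no such `α < ω₁`. -/
noncomputable def borelOrder (X : Set CantorSpace) : Ordinal.{0} :=
  sInf ({α : Ordinal.{0} | α < ω₁ ∧ BorelTraceBound X α} ∪ {ω₁})

/-! For each `β < ω₁` a generic-point argument yields a set of size at most non(M) on which `Σ⁰_β`
does not capture all Borel sets; the union of these sets over the `ℵ₁ ≤` non(M) many `β` has order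
`ω₁`.

Fix `β`. The bits of `y` label a well-founded tree of ranks up to `β + 1`, and a node is true when
its bit is 1 and its children of smaller rank are all false. "The root is true at rank `β + 1`" is a
Borel condition on `y`. Finite consistent sets of literals approximate such a labelling. Each Cohen
real `c` builds a labelling from a starting condition `p`, and comeagrely many `c` give a complete
and correct one (`nodeValue_leafPoint`).

A condition of rank below `b` cannot see more of `p` than its truncation at `b`
(`Consistent.union_of_truncation`). Hence each `Σ⁰_α` set is generically decided by conditions of
rank at most `α` (`decidedBy_of_isSigmaZero`). Such conditions of rank `β` never exclude that the
root is false at rank `β + 1`. A nonmeager set of reals `c` suffices for the argument, since it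
meets every comeager set. -/

/-! ### Conditions -/

/-- A literal `(b, s, γ)` asserts that the node `(s, γ)` has truth value `b`. -/
abbrev Literal (I : Type) : Type := Bool × List (I × ℕ) × I

section Conditions

variable {I : Type} [LinearOrder I]

/-- Consistency of a set of literals: the node `(s, γ)` is true only if `(s, γ')` is not false for
any `γ' ≤ γ`, and only if `((η, n) :: s, η)` is not true for any `η < γ`. -/
def Consistent (p : Set (Literal I)) : Prop :=
  (∀ s γ γ', (true, s, γ) ∈ p → (false, s, γ') ∈ p → γ < γ') ∧
    ∀ s γ η n δ, (true, s, γ) ∈ p → (true, (η, n) :: s, δ) ∈ p → η < γ → δ < η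

theorem Consistent.mono {p q : Set (Literal I)} (hq : Consistent q) (h : p ⊆ q) :
    Consistent p :=
  ⟨fun s γ γ' h₁ h₂ => hq.1 s γ γ' (h h₁) (h h₂),
    fun s γ η n δ h₁ h₂ => hq.2 s γ η n δ (h h₁) (h h₂)⟩

/-- The set of consequences of rank at most `b` of a set of literals. -/
def truncation (b : I) (p : Set (Literal I)) : Set (Literal I) :=
  {a | (∃ δ, (true, a.2.1, δ) ∈ p ∧ a.1 = true ∧ a.2.2 = min δ b) ∨
    (a ∈ p ∧ a.1 = false ∧ a.2.2 ≤ b)}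

theorem true_mem_truncation {b : I} {p : Set (Literal I)} {s : List (I × ℕ)} {γ : I} :
    (true, s, γ) ∈ truncation b p ↔ ∃ δ, (true, s, δ) ∈ p ∧ γ = min δ b := by
  simp [truncation]

theorem false_mem_truncation {b : I} {p : Set (Literal I)} {s : List (I × ℕ)} {γ : I} :
    (false, s, γ) ∈ truncation b p ↔ (false, s, γ) ∈ p ∧ γ ≤ b := by
  simp [truncation]

theorem truncation_rank_le {b : I} {p : Set (Literal I)} {a : Literal I}
    (h : a ∈ truncation b p) : a.2.2 ≤ b := by
  obtain ⟨δ, -, -, h⟩ | ⟨-, -, h⟩ := h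
  · exact h ▸ min_le_right _ _
  · exact h

theorem finite_truncation (b : I) {p : Set (Literal I)} (hp : p.Finite) :
    (truncation b p).Finite := by
  refine ((hp.image fun a => (a.1, a.2.1, min a.2.2 b)).union hp).subset ?_
  rintro ⟨v, s, γ⟩ (⟨δ, h₁, h₂, h₃⟩ | h)
  · exact Or.inl ⟨_, h₁, by simp_all⟩
  · exact Or.inr h.1

/-- Truth passes to smaller ranks: every true literal of the union lies below a true literal of `p`
at the same node, and no new false literals appear. -/
theorem Consistent.union_truncation {b : I} {p : Set (Literal I)} (hp : Consistent p) :
    Consistent (p ∪ truncation b p) := by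
  have ht : ∀ s γ, (true, s, γ) ∈ p ∪ truncation b p → ∃ δ, γ ≤ δ ∧ (true, s, δ) ∈ p := by
    rintro s γ (h | h)
    · exact ⟨γ, le_rfl, h⟩
    · obtain ⟨δ, hδ, rfl⟩ := true_mem_truncation.1 h
      exact ⟨δ, min_le_left _ _, hδ⟩
  have hf : ∀ s γ, (false, s, γ) ∈ p ∪ truncation b p → (false, s, γ) ∈ p := by
    rintro s γ (h | h)
    · exact h
    · exact (false_mem_truncation.1 h).1
  refine ⟨fun s γ γ' h₁ h₂ => ?_, fun s γ η n δ h₁ h₂ h₃ => ?_⟩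
  · obtain ⟨δ, hδ, h₁⟩ := ht _ _ h₁
    exact hδ.trans_lt (hp.1 _ _ _ h₁ (hf _ _ h₂))
  · obtain ⟨γ₁, hγ, h₁⟩ := ht _ _ h₁
    obtain ⟨δ₁, hδ, h₂⟩ := ht _ _ h₂
    exact hδ.trans_lt (hp.2 _ _ _ _ _ h₁ h₂ (h₃.trans_le hγ))

/-- A condition of rank less than `b` is compatible with `p` if it is compatible with the
truncation of `p` at `b`. -/
theorem Consistent.union_of_truncation {b c : I} (hcb : c < b) {p q : Set (Literal I)}
    (hp : Consistent p) (hq : ∀ a ∈ q, a.2.2 ≤ c) (h : Consistent (truncation b p ∪ q)) :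
    Consistent (p ∪ q) := by
  have hqr : ∀ v s γ, (v, s, γ) ∈ q → γ < b := fun v s γ h => (hq _ h).trans_lt hcb
  have tr : ∀ s γ, (true, s, γ) ∈ p → (true, s, min γ b) ∈ truncation b p ∪ q := fun s γ h =>
    Or.inl (true_mem_truncation.2 ⟨γ, h, rfl⟩)
  refine ⟨fun s γ γ' h₁ h₂ => ?_, fun s γ η n δ h₁ h₂ h₃ => ?_⟩
  · rcases h₁ with h₁ | h₁ <;> rcases h₂ with h₂ | h₂
    · exact hp.1 _ _ _ h₁ h₂
    · have := h.1 _ _ _ (tr _ _ h₁) (Or.inr h₂)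
      exact (min_lt_iff.1 this).resolve_right (hqr _ _ _ h₂).not_gt
    · by_contra hlt
      have hb : γ' ≤ b := (not_lt.1 hlt).trans (hqr _ _ _ h₁).le
      exact hlt (h.1 _ _ _ (Or.inr h₁) (Or.inl (false_mem_truncation.2 ⟨h₂, hb⟩)))
    · exact h.1 _ _ _ (Or.inr h₁) (Or.inr h₂)
  · rcases h₁ with h₁ | h₁ <;> rcases h₂ with h₂ | h₂
    · exact hp.2 _ _ _ _ _ h₁ h₂ h₃
    · by_contra hlt
      have hη : η < b := (not_lt.1 hlt).trans_lt (hqr _ _ _ h₂)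
      exact hlt (h.2 _ _ _ _ _ (tr _ _ h₁) (Or.inr h₂) (lt_min h₃ hη))
    · have := h.2 _ _ _ _ _ (Or.inr h₁) (tr _ _ h₂) h₃
      exact (min_lt_iff.1 this).resolve_right (h₃.trans (hqr _ _ _ h₁)).not_gt
    · exact h.2 _ _ _ _ _ (Or.inr h₁) (Or.inr h₂) h₃

/-- A false literal clashes only with true literals at the same node of at least its rank. No true
child is needed yet; genericity supplies one later. -/
theorem Consistent.insert_false {p : Set (Literal I)} (hp : Consistent p) {s : List (I × ℕ)}
    {γ : I} (h : ∀ δ, (true, s, δ) ∈ p → δ < γ) : Consistent (insert (false, s, γ) p) := by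
  refine ⟨fun s' γ₁ γ₂ h₁ h₂ => ?_, fun s' γ₁ η n δ h₁ h₂ => ?_⟩
  · replace h₁ : (true, s', γ₁) ∈ p := by simpa using h₁
    obtain h₂ | h₂ := h₂
    · simp only [Prod.mk.injEq, true_and] at h₂
      obtain ⟨rfl, rfl⟩ := h₂
      exact h _ h₁
    · exact hp.1 _ _ _ h₁ h₂
  · exact hp.2 s' γ₁ η n δ (by simpa using h₁) (by simpa using h₂)

/-- A node that is not true may be made false by making one of its children true. -/
theorem Consistent.exists_insert_child {p : Set (Literal I)} (hp : Consistent p)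
    (hfin : p.Finite) {s : List (I × ℕ)} {γ δ₀ : I} (hδ₀ : δ₀ < γ)
    (h : ∀ δ, (true, s, δ) ∈ p → δ < γ) :
    ∃ η < γ, ∃ n, Consistent (insert (true, (η, n) :: s, η) p) := by
  -- The child receives the largest of `δ₀` and the ranks at which `p` makes `s` true: this is below
  -- `γ`, yet not below any rank at which `s` is true, so no such literal forbids the child.
  have hD : (insert δ₀ {δ | (true, s, δ) ∈ p}).Finite :=
    (hfin.preimage (f := fun δ : I => (true, s, δ))
      (fun a _ b _ hab => by simpa using hab)).insert _
  obtain ⟨η, hη, hmax⟩ := Set.exists_max_image _ id hD ⟨δ₀, Set.mem_insert _ _⟩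
  have hηγ : η < γ := by
    obtain rfl | hη := hη
    exacts [hδ₀, h _ hη]
  -- a child that no literal of `p` mentions, either itself or through one of its children
  have hN : {n : ℕ | ∃ a ∈ p, (η, n) ∈ a.2.1}.Finite := by
    have : {n : ℕ | ∃ a ∈ p, (η, n) ∈ a.2.1} =
        ⋃ a ∈ p, (fun n => (η, n)) ⁻¹' {x | x ∈ a.2.1} := by ext; simp
    rw [this]
    exact hfin.biUnion fun a _ => (List.finite_toSet a.2.1).preimage
      fun a _ b _ hab => by simpa using hab
  obtain ⟨n, hn⟩ := hN.exists_notMem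
  have hn : ∀ v t δ, (v, t, δ) ∈ p → (η, n) ∉ t := fun v t δ ht hm => hn ⟨_, ht, hm⟩
  refine ⟨η, hηγ, n, fun s' γ₁ γ₂ h₁ h₂ => ?_, fun s' γ₁ η' n' δ h₁ h₂ h₃ => ?_⟩
  · replace h₂ : (false, s', γ₂) ∈ p := by simpa using h₂
    obtain h₁ | h₁ := h₁
    · simp only [Prod.mk.injEq, true_and] at h₁
      exact absurd (h₁.1 ▸ List.mem_cons_self) (hn _ _ _ h₂)
    · exact hp.1 _ _ _ h₁ h₂
  · obtain h₁ | h₁ := h₁ <;> obtain h₂ | h₂ := h₂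
    · simp only [Prod.mk.injEq, true_and, List.cons.injEq] at h₁ h₂
      obtain ⟨h₁, -⟩ := h₁
      have := congrArg List.length (h₂.1.2.symm.trans h₁)
      simp at this
    · simp only [Prod.mk.injEq, true_and] at h₁
      exact absurd (List.mem_cons_of_mem _ (h₁.1 ▸ List.mem_cons_self)) (hn _ _ _ h₂)
    · simp only [Prod.mk.injEq, true_and, List.cons.injEq] at h₂
      obtain ⟨⟨⟨rfl, rfl⟩, rfl⟩, rfl⟩ := h₂
      exact absurd h₃ (not_lt.2 (hmax _ (Or.inr h₁)))
    · exact hp.2 _ _ _ _ _ h₁ h₂ h₃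

end Conditions

/-! ### Generic sequences of conditions -/

section Generic

open Classical in
/-- The increasing sequence of conditions that starts with `p` and adds `e n` at stage `n` if
`c n` is true and the result is consistent. -/
noncomputable def conditionSeq {I : Type} [LinearOrder I] (e : ℕ → Finset (Literal I))
    (p : Finset (Literal I)) (c : CantorSpace) : ℕ → Finset (Literal I)
  | 0 => p
  | n + 1 =>
    if c n = true ∧ Consistent (↑(conditionSeq e p c n ∪ e n) : Set (Literal I)) then
      conditionSeq e p c n ∪ e n
    else conditionSeq e p c n

/-- The set of literals that are decided along `conditionSeq`. -/
def genericSet {I : Type} [LinearOrder I] (e : ℕ → Finset (Literal I))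
    (p : Finset (Literal I)) (c : CantorSpace) : Set (Literal I) :=
  {a | ∃ n, a ∈ conditionSeq e p c n}

variable {I : Type} [LinearOrder I] {e : ℕ → Finset (Literal I)} {p : Finset (Literal I)}

theorem conditionSeq_mono (c : CantorSpace) : Monotone (conditionSeq e p c) := by
  classical
  refine monotone_nat_of_le_succ fun n => ?_
  rw [conditionSeq]
  split_ifs
  · exact Finset.subset_union_left
  · exact le_rfl

theorem consistent_conditionSeq (hp : Consistent (p : Set (Literal I))) (c : CantorSpace) (n : ℕ) :
    Consistent (conditionSeq e p c n : Set (Literal I)) := by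
  classical
  induction n with
  | zero => exact hp
  | succ n ih =>
    rw [conditionSeq]
    split_ifs with h
    · exact h.2
    · exact ih

theorem conditionSeq_congr {c c' : CantorSpace} {n : ℕ} (h : ∀ k < n, c k = c' k) :
    conditionSeq e p c n = conditionSeq e p c' n := by
  induction n with
  | zero => rfl
  | succ n ih =>
    rw [conditionSeq, conditionSeq, ih fun k hk => h k (by omega), h n (by omega)]

theorem conditionSeq_eq_of_false {c : CantorSpace} {n m : ℕ} (hnm : n ≤ m)
    (h : ∀ k, n ≤ k → k < m → c k = false) :
    conditionSeq e p c m = conditionSeq e p c n := by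
  induction m, hnm using Nat.le_induction with
  | base => rfl
  | succ m hm ih =>
    rw [conditionSeq, if_neg (by simp [h m hm (by omega)]), ih fun k h₁ h₂ => h k h₁ (by omega)]

theorem exists_conditionSeq_superset {q : Finset (Literal I)} {c : CantorSpace}
    (hq : (q : Set (Literal I)) ⊆ genericSet e p c) : ∃ n, q ⊆ conditionSeq e p c n := by
  classical
  induction q using Finset.induction_on with
  | empty => exact ⟨0, by simp⟩
  | insert a q _ ih =>
    obtain ⟨n, hn⟩ := ih fun x hx => hq (by simp_all)
    obtain ⟨m, hm⟩ := hq (a := a) (by simp)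
    refine ⟨max n m, Finset.insert_subset (conditionSeq_mono c (le_max_right n m) hm) ?_⟩
    exact hn.trans (conditionSeq_mono c (le_max_left n m))

theorem consistent_genericSet (hp : Consistent (p : Set (Literal I))) (c : CantorSpace) :
    Consistent (genericSet e p c) := by
  classical
  have key : ∀ a ∈ genericSet e p c, ∀ b ∈ genericSet e p c,
      ∃ q : Finset (Literal I), Consistent (q : Set (Literal I)) ∧ a ∈ q ∧ b ∈ q := by
    rintro a ⟨n, ha⟩ b ⟨m, hb⟩
    exact ⟨_, consistent_conditionSeq hp c (max n m), conditionSeq_mono c (le_max_left n m) ha,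
      conditionSeq_mono c (le_max_right n m) hb⟩
  refine ⟨fun s γ γ' h₁ h₂ => ?_, fun s γ η n δ h₁ h₂ => ?_⟩
  · obtain ⟨q, hq, h₁, h₂⟩ := key _ h₁ _ h₂
    exact hq.1 _ _ _ h₁ h₂
  · obtain ⟨q, hq, h₁, h₂⟩ := key _ h₁ _ h₂
    exact hq.2 _ _ _ _ _ h₁ h₂

theorem subset_genericSet (c : CantorSpace) : (p : Set (Literal I)) ⊆ genericSet e p c :=
  fun _ ha => ⟨0, ha⟩

theorem exists_cylinder_subset {U : Set CantorSpace} (hU : IsOpen U) {c : CantorSpace}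
    (hc : c ∈ U) : ∃ n, ∀ c' : CantorSpace, (∀ k < n, c k = c' k) → c' ∈ U := by
  obtain ⟨J, u, hu, hJ⟩ := isOpen_pi_iff.1 hU c hc
  refine ⟨J.sup id + 1, fun c' h => hJ fun k hk => ?_⟩
  rw [← h k (Nat.lt_succ_of_le (Finset.le_sup (f := id) hk))]
  exact (hu k hk).2

theorem isOpen_of_cylinder {U : Set CantorSpace}
    (h : ∀ c ∈ U, ∃ n, ∀ c' : CantorSpace, (∀ k < n, c k = c' k) → c' ∈ U) : IsOpen U := by
  refine isOpen_pi_iff.2 fun c hc => ?_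
  obtain ⟨n, hn⟩ := h c hc
  refine ⟨Finset.range n, fun k => {c k}, fun k _ => ⟨isOpen_discrete _, rfl⟩, fun c' hc' => ?_⟩
  exact hn c' fun k hk => (hc' k (by simpa using hk)).symm

/-- Every dense set of conditions is met by the sequence, for comeagrely many `c`. -/
theorem eventually_residual_exists_mem (he : ∀ q n, ∃ m, n ≤ m ∧ e m = q)
    (hp : Consistent (p : Set (Literal I))) {D : Set (Finset (Literal I))}
    (hD : ∀ q : Finset (Literal I), Consistent (q : Set (Literal I)) →
      ∃ d ∈ D, q ⊆ d ∧ Consistent (d : Set (Literal I))) :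
    ∀ᶠ c in residual CantorSpace, ∃ n, conditionSeq e p c n ∈ D := by
  classical
  refine residual_of_dense_open (isOpen_of_cylinder ?_) (dense_iff_inter_open.2 ?_)
  · rintro c ⟨n, hn⟩
    exact ⟨n, fun c' h => ⟨n, by rwa [← conditionSeq_congr h]⟩⟩
  · rintro W hW ⟨c, hc⟩
    obtain ⟨n, hn⟩ := exists_cylinder_subset hW hc
    obtain ⟨d, hd, hsub, hcon⟩ := hD _ (consistent_conditionSeq (e := e) hp c n)
    obtain ⟨m, hnm, rfl⟩ := he d n
    -- Follow `c` up to stage `n`, then decline every offer until `d` comes up at stage `m`.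
    set c' : CantorSpace := fun k => if k < n then c k else decide (k = m) with hc'
    have h₁ : ∀ k < n, c k = c' k := fun k hk => by simp [hc', hk]
    refine ⟨c', hn c' h₁, m + 1, ?_⟩
    have h₂ : conditionSeq e p c' m = conditionSeq e p c n := by
      rw [conditionSeq_congr h₁]
      refine conditionSeq_eq_of_false hnm fun k h₁ h₂ => ?_
      simp [hc', h₁.not_gt, h₂.ne]
    have h₃ : c' m = true := by simp [hc', hnm.not_gt]
    have h₄ : conditionSeq e p c n ∪ e m = e m := Finset.union_eq_right.2 hsub
    rw [conditionSeq, h₂, h₄, if_pos ⟨h₃, hcon⟩]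
    exact hd

theorem eventually_residual_decided [Countable I] (he : ∀ q n, ∃ m, n ≤ m ∧ e m = q)
    (hp : Consistent (p : Set (Literal I))) :
    ∀ᶠ c in residual CantorSpace, ∀ s γ,
      (true, s, γ) ∈ genericSet e p c ∨ (false, s, γ) ∈ genericSet e p c := by
  classical
  refine eventually_countable_forall.2 fun s => eventually_countable_forall.2 fun γ => ?_
  have := eventually_residual_exists_mem he hp
    (D := {q | (true, s, γ) ∈ q ∨ (false, s, γ) ∈ q})
    fun q hq => by
      -- Either `q` already implies that the node is true, or it tolerates its being false.
      by_cases h : ∃ δ, γ ≤ δ ∧ (true, s, δ) ∈ q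
      · obtain ⟨δ, hδ, h⟩ := h
        have hc := hq.union_truncation (b := γ)
        have hm : (true, s, γ) ∈ truncation γ (q : Set (Literal I)) :=
          true_mem_truncation.2 ⟨δ, h, (min_eq_right hδ).symm⟩
        refine ⟨insert (true, s, γ) q, Or.inl (by simp),
          Finset.subset_insert _ _, hc.mono ?_⟩
        rw [Finset.coe_insert]
        exact Set.insert_subset (Or.inr hm) Set.subset_union_left
      · push Not at h
        refine ⟨insert (false, s, γ) q, Or.inr (by simp), Finset.subset_insert _ _, ?_⟩
        rw [Finset.coe_insert]
        exact hq.insert_false fun δ hδ => lt_of_not_ge fun hle => h δ hle hδ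
  filter_upwards [this] with c ⟨n, hn⟩
  exact hn.imp (⟨n, ·⟩) (⟨n, ·⟩)

theorem eventually_residual_witnessed [OrderBot I] [Countable I] (he : ∀ q n, ∃ m, n ≤ m ∧ e m = q)
    (hp : Consistent (p : Set (Literal I))) :
    ∀ᶠ c in residual CantorSpace, ∀ s γ, ⊥ < γ → (false, s, γ) ∈ genericSet e p c →
      ∃ η < γ, ∃ n, (true, (η, n) :: s, η) ∈ genericSet e p c := by
  classical
  refine eventually_countable_forall.2 fun s => eventually_countable_forall.2 fun γ => ?_
  rcases (bot_le (a := γ)).eq_or_lt with hγ | hγ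
  · exact Filter.Eventually.of_forall fun c h => absurd hγ h.ne
  have := eventually_residual_exists_mem he hp
    (D := {q | (∃ δ, γ ≤ δ ∧ (true, s, δ) ∈ q) ∨ ∃ η < γ, ∃ n, (true, (η, n) :: s, η) ∈ q})
    fun q hq => by
      by_cases h : ∃ δ, γ ≤ δ ∧ (true, s, δ) ∈ q
      · exact ⟨q, Or.inl h, subset_rfl, hq⟩
      · push Not at h
        obtain ⟨η, hη, n, hc⟩ := hq.exists_insert_child q.finite_toSet hγ
          fun δ hδ => lt_of_not_ge fun hle => h δ hle hδ
        refine ⟨insert (true, (η, n) :: s, η) q, Or.inr ⟨η, hη, n, by simp⟩,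
          Finset.subset_insert _ _, ?_⟩
        rwa [Finset.coe_insert]
  filter_upwards [this] with c ⟨n, hn⟩ _ hf
  obtain ⟨δ, hδ, h⟩ | ⟨η, hη, k, h⟩ := hn
  · exact absurd ((consistent_genericSet hp c).1 _ _ _ ⟨n, h⟩ hf) hδ.not_gt
  · exact ⟨η, hη, k, n, h⟩

end Generic

/-! ### Evaluation of nodes -/

section Evaluation

variable {I : Type} [LinearOrder I]

/-- The truth value of the node `(s, γ)` computed from the values of the nodes of rank `⊥`. -/
def nodeValue [WellFoundedLT I] (y : List (I × ℕ) → Bool) (γ : I) (s : List (I × ℕ)) : Prop :=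
  y s = true ∧ ∀ η, (_ : η < γ) → ∀ n, ¬ nodeValue y η ((η, n) :: s)
termination_by (wellFounded_lt (α := I)).wrap γ
decreasing_by assumption

theorem measurableSet_nodeValue [WellFoundedLT I] [Countable I] (k : List (I × ℕ) → ℕ) (γ : I)
    (s : List (I × ℕ)) : MeasurableSet {y : CantorSpace | nodeValue (fun t => y (k t)) γ s} := by
  induction γ using WellFoundedLT.induction generalizing s with
  | ind γ ih =>
    have h : {y : CantorSpace | nodeValue (fun t => y (k t)) γ s} =
        {y | y (k s) = true} ∩ ⋂ η, ⋂ (_ : η < γ), ⋂ n : ℕ,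
          {y : CantorSpace | nodeValue (fun t => y (k t)) η ((η, n) :: s)}ᶜ := by
      ext y
      simp only [Set.mem_ofPred_eq, Set.mem_inter_iff, Set.mem_iInter, Set.mem_compl_iff]
      rw [nodeValue]
    rw [h]
    refine .inter (measurableSet_eq_fun (measurable_pi_apply (k s)) measurable_const) ?_
    exact .iInter fun η => .iInter fun hη => .iInter fun n => (ih η hη _).compl

variable [OrderBot I]

open Classical in
/-- The point of the Cantor space read off from a set of literals. -/
noncomputable def leafPoint (k : ℕ → List (I × ℕ)) (G : Set (Literal I)) : CantorSpace :=
  fun i => decide ((true, k i, ⊥) ∈ G)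

/-- By induction on rank: consistency forbids a true node from having a true child of smaller rank,
and `h₂` gives every false node of positive rank a true child. -/
theorem nodeValue_leafPoint [WellFoundedLT I] (k : ℕ ≃ List (I × ℕ)) {G : Set (Literal I)}
    (hG : Consistent G) (h₁ : ∀ s γ, (true, s, γ) ∈ G ∨ (false, s, γ) ∈ G)
    (h₂ : ∀ s γ, ⊥ < γ → (false, s, γ) ∈ G → ∃ η < γ, ∃ n, (true, (η, n) :: s, η) ∈ G)
    (γ : I) (s : List (I × ℕ)) :
    nodeValue (fun t => leafPoint k G (k.symm t)) γ s ↔ (true, s, γ) ∈ G := by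
  induction γ using WellFoundedLT.induction generalizing s with
  | ind γ ih =>
    rw [nodeValue]
    simp only [leafPoint, Equiv.apply_symm_apply, decide_eq_true_eq]
    constructor
    · rintro ⟨hs, hc⟩
      refine (h₁ s γ).resolve_right fun hf => ?_
      have hγ : ⊥ < γ := hG.1 _ _ _ hs hf
      obtain ⟨η, hη, n, h⟩ := h₂ _ _ hγ hf
      exact hc η hη n ((ih η hη _).2 h)
    · intro ht
      refine ⟨(h₁ s ⊥).resolve_right fun hf => not_lt_bot (hG.1 _ _ _ ht hf), fun η hη n hc => ?_⟩
      exact lt_irrefl _ (hG.2 _ _ _ _ _ ht ((ih η hη _).1 hc) hη)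

end Evaluation

/-! ### Deciding Borel sets by conditions of bounded rank -/

section Forcing

/-- The set `B` is decided by conditions of rank at most `b`. -/
def DecidedBy {I : Type} [LinearOrder I] [OrderBot I] (e : ℕ → Finset (Literal I))
    (k : ℕ → List (I × ℕ)) (b : I) (B : Set CantorSpace) : Prop :=
  ∃ U : Set (Finset (Literal I)), (∀ q ∈ U, ∀ a ∈ q, a.2.2 ≤ b) ∧
    ∀ p : Finset (Literal I), Consistent (p : Set (Literal I)) →
      ∀ᶠ c in residual CantorSpace, leafPoint k (genericSet e p c) ∈ B ↔
        ∃ q ∈ U, (q : Set (Literal I)) ⊆ genericSet e p c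

variable {I : Type} [LinearOrder I] [OrderBot I] {e : ℕ → Finset (Literal I)}

theorem decidedBy_of_isOpen [Countable I] (he : ∀ q n, ∃ m, n ≤ m ∧ e m = q) (k : ℕ → List (I × ℕ)) (b : I)
    {B : Set CantorSpace} (hB : IsOpen B) : DecidedBy e k b B := by
  classical
  -- Membership in an open set depends on finitely many bits, that is, on finitely many literals of
  -- rank `⊥`.
  refine ⟨{q | (∀ a ∈ q, a.2.2 ≤ b) ∧
    ∀ y : CantorSpace, (∀ i v, (v, k i, ⊥) ∈ q → y i = v) → y ∈ B}, fun q hq => hq.1,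
    fun p hp => ?_⟩
  filter_upwards [eventually_residual_decided he hp] with c hc
  have hG := consistent_genericSet (e := e) hp c
  set y := leafPoint k (genericSet e p c) with hy
  constructor
  · intro hyB
    obtain ⟨n, hn⟩ := exists_cylinder_subset hB hyB
    refine ⟨(Finset.range n).image fun i => (y i, k i, ⊥), ⟨?_, fun z hz => hn z fun i hi => ?_⟩, ?_⟩
    · simp
    · exact (hz i (y i) (Finset.mem_image_of_mem _ (Finset.mem_range.2 hi))).symm
    · intro a ha
      obtain ⟨i, -, rfl⟩ := Finset.mem_image.1 ha
      by_cases h : (true, k i, ⊥) ∈ genericSet e p c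
      · simp [hy, leafPoint, h]
      · simpa [hy, leafPoint, h] using (hc (k i) ⊥).resolve_left h
  · rintro ⟨q, ⟨-, hq⟩, hqG⟩
    refine hq y fun i v hv => ?_
    have hv := hqG hv
    cases v with
    | true => simpa [hy, leafPoint] using hv
    | false =>
      simp only [hy, leafPoint, decide_eq_false_iff_not]
      exact fun ht => lt_irrefl _ (hG.1 _ _ _ ht hv)

/-- Forcing `A n` means being incompatible with everything that forces its complement. If `q` is so,
then its truncation at `b` is too, because `c n < b`; so conditions of rank at most `b` suffice. -/
theorem decidedBy_iUnion (he : ∀ q n, ∃ m, n ≤ m ∧ e m = q) {k : ℕ → List (I × ℕ)} {b : I}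
    {A : ℕ → Set CantorSpace} {c : ℕ → I} (hc : ∀ n, c n < b)
    (hA : ∀ n, DecidedBy e k (c n) (A n)ᶜ) : DecidedBy e k b (⋃ n, A n) := by
  classical
  choose U hU hUA using hA
  let V : ℕ → Set (Finset (Literal I)) := fun n =>
    {r | (∀ a ∈ r, a.2.2 ≤ b) ∧ ∀ q ∈ U n, ¬ Consistent (↑(r ∪ q) : Set (Literal I))}
  refine ⟨⋃ n, V n, fun r hr => ?_, fun p hp => ?_⟩
  · obtain ⟨n, hn⟩ := Set.mem_iUnion.1 hr
    exact hn.1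
  have hdense : ∀ n, ∀ᶠ x in residual CantorSpace, ∃ m, conditionSeq e p x m ∈
      {d | ∃ r ∈ U n ∪ V n, r ⊆ d} := by
    refine fun n => eventually_residual_exists_mem he hp fun q hq => ?_
    by_cases h : ∃ r ∈ U n, Consistent (↑(q ∪ r) : Set (Literal I))
    · obtain ⟨r, hr, hqr⟩ := h
      exact ⟨q ∪ r, ⟨r, Or.inl hr, Finset.subset_union_right⟩, Finset.subset_union_left, hqr⟩
    · push Not at h
      have hfin := finite_truncation b q.finite_toSet
      refine ⟨q ∪ hfin.toFinset, ⟨hfin.toFinset, Or.inr ⟨fun a ha => ?_, fun r hr hcon => ?_⟩,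
        Finset.subset_union_right⟩, Finset.subset_union_left, ?_⟩
      · exact truncation_rank_le (hfin.mem_toFinset.1 ha)
      · refine h r hr ?_
        rw [Finset.coe_union, Set.Finite.coe_toFinset] at hcon
        rw [Finset.coe_union]
        exact hq.union_of_truncation (hc n) (hU n r hr) hcon
      · rw [Finset.coe_union, Set.Finite.coe_toFinset]
        exact hq.union_truncation
  filter_upwards [eventually_countable_forall.2 hdense,
    eventually_countable_forall.2 fun n => hUA n p hp] with x hx hxA
  have hG := consistent_genericSet (e := e) hp x
  have key : ∀ n, leafPoint k (genericSet e p x) ∈ A n ↔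
      ∃ r ∈ V n, (r : Set (Literal I)) ⊆ genericSet e p x := by
    intro n
    rw [← not_iff_not, ← Set.mem_compl_iff, hxA n]
    constructor
    · rintro ⟨q, hq, hqG⟩ ⟨r, hr, hrG⟩
      refine hr.2 q hq (hG.mono ?_)
      rw [Finset.coe_union]
      exact Set.union_subset hrG hqG
    · intro h
      obtain ⟨m, r, hr, hrm⟩ := hx n
      have hrG : (r : Set (Literal I)) ⊆ genericSet e p x := fun a ha => ⟨m, hrm ha⟩
      exact hr.elim (fun hr => ⟨r, hr, hrG⟩) fun hr => absurd ⟨r, hr, hrG⟩ h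
  simp only [Set.mem_iUnion, key]
  exact ⟨fun ⟨n, r, hr, h⟩ => ⟨r, ⟨n, hr⟩, h⟩, fun ⟨r, ⟨n, hr⟩, h⟩ => ⟨n, r, hr, h⟩⟩


theorem decidedBy_of_isSigmaZero [Countable I] {o : Ordinal.{0}} (r : Set.Iio o ≃o I)
    (he : ∀ q n, ∃ m, n ≤ m ∧ e m = q) (k : ℕ → List (I × ℕ)) {α : Ordinal.{0}}
    {B : Set CantorSpace} (hB : IsSigmaZero α B) : ∀ hα : α < o, DecidedBy e k (r ⟨α, hα⟩) B := by
  induction hB with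
  | of_isOpen U hU => exact fun _ => decidedBy_of_isOpen he k _ hU
  | iUnion α _ A β hβ _ ih =>
    exact fun hα => decidedBy_iUnion he (c := fun n => r ⟨β n, (hβ n).trans hα⟩)
      (fun n => r.lt_iff_lt.2 (hβ n)) fun n => ih n _

end Forcing

/-! ### Sets of large Borel order -/

theorem Set.Countable.isMeagre_cantorSpace {Y : Set CantorSpace} (hY : Y.Countable) :
    IsMeagre Y := by
  rw [← Set.biUnion_of_singleton Y]
  refine isMeagre_biUnion hY fun y _ => ?_
  refine residual_of_dense_open isOpen_compl_singleton (dense_iff_inter_open.2 ?_)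
  rintro W hW ⟨c, hc⟩
  obtain ⟨n, hn⟩ := exists_cylinder_subset hW hc
  refine ⟨fun i => if i < n then c i else !(y i), hn _ fun i hi => by simp [hi], fun h => ?_⟩
  simpa using congrFun h n

theorem exists_not_isMeagre_mk_eq :
    ∃ Y : Set CantorSpace, ¬ IsMeagre Y ∧ #Y = nonMeager := by
  refine csInf_mem (s := {κ | ∃ Y : Set CantorSpace, ¬ IsMeagre Y ∧ #Y = κ}) ⟨_, Set.univ, ?_, rfl⟩
  exact not_isMeagre_of_isOpen isOpen_univ Set.univ_nonempty

theorem aleph_one_le_nonMeager : ℵ₁ ≤ nonMeager := by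
  obtain ⟨Y, hY, h⟩ := exists_not_isMeagre_mk_eq
  rw [← h, ← Cardinal.succ_aleph0, Order.succ_le_iff]
  by_contra hlt
  exact hY (Set.Countable.isMeagre_cantorSpace (Cardinal.le_aleph0_iff_set_countable.1 (not_lt.1 hlt)))

theorem exists_mk_le_nonMeager_not_borelTraceBound {β : Ordinal.{0}} (hβ : β < ω₁) :
    ∃ X : Set CantorSpace, #X ≤ nonMeager ∧ ¬ BorelTraceBound X β := by
  classical
  obtain ⟨Y, hY, hYcard⟩ := exists_not_isMeagre_mk_eq
  have hω : β + 1 + 1 < ω₁ :=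
    (Cardinal.isSuccLimit_omega 1).succ_lt ((Cardinal.isSuccLimit_omega 1).succ_lt hβ)
  -- The ranks are the ordinals up to `β + 1`, so that the top rank lies strictly above the image of
  -- `β`.
  let I : Type := (β + 1 + 1).ToType
  let r : Set.Iio (β + 1 + 1) ≃o I := Ordinal.ToType.mk
  have hlt : β < β + 1 := Order.lt_succ β
  have hlt' : β + 1 < β + 1 + 1 := Order.lt_succ (β + 1)
  let top : I := r ⟨β + 1, hlt'⟩
  have hcount : Countable I := by
    rw [← Cardinal.mk_le_aleph0_iff, Cardinal.mk_toType, ← Order.lt_succ_iff, Cardinal.succ_aleph0]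
    exact Cardinal.lt_omega_iff_card_lt.1 hω
  have : Nonempty I := ⟨top⟩
  let _ : OrderBot I := WellFoundedLT.toOrderBot I
  obtain ⟨k⟩ : Nonempty (ℕ ≃ List (I × ℕ)) := by
    obtain ⟨_⟩ := nonempty_denumerable (List (I × ℕ))
    exact ⟨(Denumerable.eqv _).symm⟩
  obtain ⟨g, hg⟩ := exists_surjective_nat (Finset (Literal I))
  let e : ℕ → Finset (Literal I) := fun m => g m.unpair.1
  have he : ∀ q n, ∃ m, n ≤ m ∧ e m = q := fun q n => by
    obtain ⟨i, rfl⟩ := hg q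
    exact ⟨Nat.pair i n, Nat.right_le_pair i n, by simp [e]⟩
  -- All starting conditions are included because the second one used below depends on `B`; there
  -- are only countably many.
  let X : Set CantorSpace := ⋃ p : Finset (Literal I), (fun c => leafPoint k (genericSet e p c)) '' Y
  refine ⟨X, ?_, fun hX => ?_⟩
  · have h₀ : ℵ₀ ≤ nonMeager := (Cardinal.aleph0_le_aleph 1).trans aleph_one_le_nonMeager
    refine (Cardinal.mk_iUnion_le _).trans ?_
    refine (mul_le_mul' (Cardinal.mk_le_aleph0.trans h₀) (ciSup_le' fun p => ?_)).trans
      (Cardinal.mul_eq_self h₀).le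
    exact Cardinal.mk_image_le.trans hYcard.le
  let A : Set CantorSpace := {y | nodeValue (fun t => y (k.symm t)) top []}
  obtain ⟨B, hB, hAB⟩ := hX A (by
    rw [← BorelSpace.measurable_eq]
    exact measurableSet_nodeValue _ _ _)
  obtain ⟨U, hUr, hU⟩ := decidedBy_of_isSigmaZero r he k hB (hlt.trans hlt')
  have key : ∀ p : Finset (Literal I), Consistent (p : Set (Literal I)) →
      ∃ G : Set (Literal I), Consistent G ∧ (p : Set (Literal I)) ⊆ G ∧
        ((true, [], top) ∈ G ↔ ∃ q ∈ U, (q : Set (Literal I)) ⊆ G) := by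
    intro p hp
    obtain ⟨c, hcY, h₁, h₂, h₃⟩ : ∃ c ∈ Y, (∀ s γ,
          (true, s, γ) ∈ genericSet e p c ∨ (false, s, γ) ∈ genericSet e p c) ∧
        (∀ s γ, ⊥ < γ → (false, s, γ) ∈ genericSet e p c →
          ∃ η < γ, ∃ n, (true, (η, n) :: s, η) ∈ genericSet e p c) ∧
        (leafPoint k (genericSet e p c) ∈ B ↔
          ∃ q ∈ U, (q : Set (Literal I)) ⊆ genericSet e p c) := by
      by_contra hcon
      refine hY ?_
      filter_upwards [eventually_residual_decided he hp, eventually_residual_witnessed he hp,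
        hU p hp] with c h₁ h₂ h₃ hcY
      exact hcon ⟨c, hcY, h₁, h₂, h₃⟩
    have hG := consistent_genericSet (e := e) hp c
    refine ⟨_, hG, subset_genericSet c, ?_⟩
    rw [← h₃, ← nodeValue_leafPoint k hG h₁ h₂]
    have hcX : leafPoint k (genericSet e p c) ∈ X := Set.mem_iUnion.2 ⟨p, c, hcY, rfl⟩
    have := Set.ext_iff.1 hAB (leafPoint k (genericSet e p c))
    simp only [Set.mem_inter_iff, hcX, and_true] at this
    exact this
  -- Start with a true root: some `q ∈ U` then forces `B`. Its ranks lie below `top`, so a false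
  -- root can be added to it, and a generic point through that condition lies in `B` but not in `A`.
  obtain ⟨G, hG, hpG, h⟩ := key {(true, [], top)} (by
    refine ⟨?_, ?_⟩ <;> simp)
  obtain ⟨q, hq, hqG⟩ := h.1 (hpG (by simp))
  obtain ⟨G', hG', hpG', h'⟩ := key (insert (false, [], top) q) (by
    rw [Finset.coe_insert]
    refine (hG.mono hqG).insert_false fun δ hδ => ?_
    exact lt_of_le_of_lt (hUr q hq _ hδ) (r.lt_iff_lt.2 hlt))
  rw [Finset.coe_insert, Set.insert_subset_iff] at hpG'
  exact lt_irrefl _ (hG'.1 _ _ _ (h'.2 ⟨q, hq, hpG'.2⟩) hpG'.1)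

theorem BorelTraceBound.mono {X X' : Set CantorSpace} {α : Ordinal.{0}}
    (h : BorelTraceBound X' α) (hX : X ⊆ X') : BorelTraceBound X α := by
  intro A hA
  obtain ⟨B, hB, hAB⟩ := h A hA
  refine ⟨B, hB, ?_⟩
  rw [← Set.inter_eq_self_of_subset_right hX, ← Set.inter_assoc, hAB, Set.inter_assoc]

theorem mainTheorem2 :
    ∃ X : Set CantorSpace, #X ≤ nonMeager ∧ borelOrder X = ω₁ := by
  choose X hXcard hX using fun i : (ω₁ : Ordinal.{0}).ToType =>
    exists_mk_le_nonMeager_not_borelTraceBound (Ordinal.typein_lt_self i)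
  refine ⟨⋃ i, X i, ?_, ?_⟩
  · have h₀ : ℵ₀ ≤ nonMeager := (Cardinal.aleph0_le_aleph 1).trans aleph_one_le_nonMeager
    refine (Cardinal.mk_iUnion_le X).trans ?_
    refine (mul_le_mul' (?_ : _ ≤ nonMeager) (ciSup_le' hXcard)).trans (Cardinal.mul_eq_self h₀).le
    simpa using aleph_one_le_nonMeager
  · have : {α : Ordinal.{0} | α < ω₁ ∧ BorelTraceBound (⋃ i, X i) α} = ∅ := by
      refine Set.eq_empty_of_forall_notMem fun α ⟨hα, h⟩ => ?_
      obtain ⟨i, rfl⟩ := Ordinal.typein_surj (α := (ω₁ : Ordinal.{0}).ToType) (· < ·)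
        (by simpa using hα)
      exact hX i (h.mono (Set.subset_iUnion X i))
    rw [borelOrder, this, Set.empty_union, csInf_singleton]
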